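/- Let $\mathbb K$ be $\mathbb R$ or $\mathbb C$. Let $E$ and $F_k$, $k\in\mathbb N$, be Fréchet spaces over $\mathbb K$, let $F_k'$ be the strong dual of $F_k$ (the continuous dual with the topology of uniform convergence on bounded sets), and let continuous linear linking maps $u_{k,l}\colon F_k'\to F_l'$ ($k\le l$) be given with $u_{k,k}=\mathrm{id}$ and $u_{l,m}\circ u_{k,l}=u_{k,m}$ for $k\le l\le m$. For locally convex spaces $X,Y$ let $X\otimes_\iota Y$ be the tensor product with the finest locally convex topology for which the canonical bilinear map $X\times Y\to X\otimes Y$ is partially (separately) continuous, and let $X\widehat\otimes_\iota Y$ be its (Hausdorff) completion. For a sequence of locally convex spaces $G_k$ with linking maps let $\operatorname{ind\,lim}_k G_k$ be the algebraic inductive limit with the finest locally convex topology for which all canonical maps from the $G_k$ are continuous. The spaces $E\widehat\otimes_\iota F_k'$ are linked by the continuous extensions of $\mathrm{id}_E\otimes u_{k,l}$. If $\operatorname{ind\,lim}_k (E\widehat\otimes_\iota F_k')$ is Hausdorff and complete, then $$E\widehat\otimes_\iota \bigl(\operatorname{ind\,lim}_k F_k'\bigr)\;\cong\;\operatorname{ind\,lim}_k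 \bigl(E\widehat\otimes_\iota F_k'\bigr)$$ as topological vector spaces, through an isomorphism that maps $x\otimes [y]$ to $[x\otimes y]$ for all $k\in\mathbb N$, $x\in E$ and $y\in F_k'$, where $[\,\cdot\,]$ denotes the image of an element of the $k$-th step in the respective inductive limit. -/

import Mathlib

open scoped TensorProduct Topology

/-- A Fréchet space over `𝕜`: a Hausdorff locally convex space (over `ℝ` or `ℂ`, this means that the
topology is given by seminorms) which is first countable (equivalently, metrizable) and complete. -/
class FrechetSpace (𝕜 E : Type*) [RCLike 𝕜] [AddCommGroup E] [Module 𝕜 E] [UniformSpace E] : Prop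
    extends IsUniformAddGroup E, PolynormableSpace 𝕜 E, T2Space E, FirstCountableTopology E,
      CompleteSpace E

/-! ### The inductive tensor product -/

/-- The algebraic tensor product `E ⊗ F`, to be given the inductive topology. -/
def InductiveTensor (𝕜 E F : Type*) [RCLike 𝕜] [AddCommGroup E] [Module 𝕜 E]
    [AddCommGroup F] [Module 𝕜 F] : Type _ :=
  E ⊗[𝕜] F

namespace InductiveTensor

section Basic

variable (𝕜 E F : Type*) [RCLike 𝕜] [AddCommGroup E] [Module 𝕜 E] [AddCommGroup F] [Module 𝕜 F]

noncomputable instance : AddCommGroup (InductiveTensor 𝕜 E F) :=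
  inferInstanceAs (AddCommGroup (E ⊗[𝕜] F))

noncomputable instance : Module 𝕜 (InductiveTensor 𝕜 E F) :=
  inferInstanceAs (Module 𝕜 (E ⊗[𝕜] F))

/-- The canonical bilinear map `E × F → E ⊗ F`. -/
noncomputable def mk : E →ₗ[𝕜] F →ₗ[𝕜] InductiveTensor 𝕜 E F :=
  TensorProduct.mk 𝕜 E F

variable {E F} in
/-- The elementary tensor `x ⊗ y`. -/
noncomputable def tmul (x : E) (y : F) : InductiveTensor 𝕜 E F :=
  mk 𝕜 E F x y

variable [TopologicalSpace E] [TopologicalSpace F]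

/-- The locally convex topologies on `E ⊗ F` for which the canonical bilinear map
`E × F → E ⊗ F` is partially (i.e. separately) continuous. -/
def admissibleTopologies : Set (TopologicalSpace (InductiveTensor 𝕜 E F)) :=
  {t | PolynormableSpace 𝕜 (InductiveTensor 𝕜 E F) (topology := t) ∧
    (∀ x : E, Continuous[inferInstance, t] fun y : F => tmul 𝕜 x y) ∧
    (∀ y : F, Continuous[inferInstance, t] fun x : E => tmul 𝕜 x y)}

/-- The inductive topology: the finest locally convex topology on `E ⊗ F` for which the
canonical bilinear map is partially continuous. (In Mathlib's order on topologies, the finest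
topology is the smallest one; see `isLeast_topology`.) -/
@[reducible] def topology : TopologicalSpace (InductiveTensor 𝕜 E F) :=
  sInf (admissibleTopologies 𝕜 E F)

theorem isLeast_topology : IsLeast (admissibleTopologies 𝕜 E F) (topology 𝕜 E F) := by
  refine ⟨⟨PolynormableSpace.sInf fun t ht => ht.1, fun x => ?_, fun y => ?_⟩,
    fun t ht => sInf_le ht⟩
  · exact continuous_sInf_rng.2 fun t ht => ht.2.1 x
  · exact continuous_sInf_rng.2 fun t ht => ht.2.2 y

theorem isTopologicalAddGroup_topology :
    @IsTopologicalAddGroup (InductiveTensor 𝕜 E F) (topology 𝕜 E F) _ :=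
  letI := topology 𝕜 E F
  haveI : PolynormableSpace 𝕜 (InductiveTensor 𝕜 E F) := (isLeast_topology 𝕜 E F).1.1
  (PolynormableSpace.withSeminorms 𝕜 (InductiveTensor 𝕜 E F)).topologicalAddGroup

/-- `E ⊗ F` carries the inductive topology and the uniform structure that belongs to it. -/
noncomputable instance : UniformSpace (InductiveTensor 𝕜 E F) :=
  @IsTopologicalAddGroup.rightUniformSpace _ _ (topology 𝕜 E F)
    (isTopologicalAddGroup_topology 𝕜 E F)

theorem toTopologicalSpace_eq :
    (inferInstance : TopologicalSpace (InductiveTensor 𝕜 E F)) = topology 𝕜 E F := rfl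

instance : PolynormableSpace 𝕜 (InductiveTensor 𝕜 E F) :=
  (isLeast_topology 𝕜 E F).1.1

instance : ContinuousSMul 𝕜 (InductiveTensor 𝕜 E F) :=
  (PolynormableSpace.withSeminorms 𝕜 _).continuousSMul

instance : IsUniformAddGroup (InductiveTensor 𝕜 E F) :=
  letI := topology 𝕜 E F
  haveI := isTopologicalAddGroup_topology 𝕜 E F
  isUniformAddGroup_of_addCommGroup

instance : UniformContinuousConstSMul 𝕜 (InductiveTensor 𝕜 E F) :=
  uniformContinuousConstSMul_of_continuousConstSMul 𝕜 _

end Basic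

section Map

variable {𝕜 E F F' : Type*} [RCLike 𝕜] [AddCommGroup E] [Module 𝕜 E] [AddCommGroup F] [Module 𝕜 F]
  [AddCommGroup F'] [Module 𝕜 F'] [TopologicalSpace E] [TopologicalSpace F] [TopologicalSpace F']

theorem continuous_of_partial {Z : Type*} [AddCommGroup Z] [Module 𝕜 Z] [TopologicalSpace Z]
    [PolynormableSpace 𝕜 Z] (f : InductiveTensor 𝕜 E F →ₗ[𝕜] Z)
    (h₁ : ∀ x : E, Continuous fun y : F => f (tmul 𝕜 x y))
    (h₂ : ∀ y : F, Continuous fun x : E => f (tmul 𝕜 x y)) : Continuous f := by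
  rw [continuous_iff_le_induced]
  exact (isLeast_topology 𝕜 E F).2 ⟨PolynormableSpace.induced f,
    fun x => continuous_induced_rng.2 (h₁ x), fun y => continuous_induced_rng.2 (h₂ y)⟩

variable (E) in
/-- The linear map `id ⊗ g : E ⊗ F → E ⊗ F'`. -/
noncomputable def algLmap (g : F →L[𝕜] F') : InductiveTensor 𝕜 E F →ₗ[𝕜] InductiveTensor 𝕜 E F' :=
  LinearMap.lTensor E (g : F →ₗ[𝕜] F')

variable (𝕜 E) in
/-- The continuous linear map `id ⊗ g : E ⊗_ι F → E ⊗_ι F'`. -/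
noncomputable def lmap (g : F →L[𝕜] F') : InductiveTensor 𝕜 E F →L[𝕜] InductiveTensor 𝕜 E F' where
  toLinearMap := algLmap E g
  cont := continuous_of_partial (algLmap E g)
    (fun x => ((isLeast_topology 𝕜 E F').1.2.1 x).comp g.continuous)
    (fun y => (isLeast_topology 𝕜 E F').1.2.2 (g y))

theorem lmap_tmul (g : F →L[𝕜] F') (x : E) (y : F) :
    lmap 𝕜 E g (tmul 𝕜 x y) = tmul 𝕜 x (g y) := rfl

end Map

end InductiveTensor

/-- The completed inductive tensor product: the (Hausdorff) completion of `E ⊗_ι F`. -/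
abbrev CompletedInductiveTensor (𝕜 E F : Type*) [RCLike 𝕜] [AddCommGroup E] [Module 𝕜 E]
    [AddCommGroup F] [Module 𝕜 F] [TopologicalSpace E] [TopologicalSpace F] : Type _ :=
  UniformSpace.Completion (InductiveTensor 𝕜 E F)

namespace CompletedInductiveTensor

variable {𝕜 E F F' : Type*} [RCLike 𝕜] [AddCommGroup E] [Module 𝕜 E] [AddCommGroup F] [Module 𝕜 F]
  [AddCommGroup F'] [Module 𝕜 F'] [TopologicalSpace E] [TopologicalSpace F] [TopologicalSpace F']

variable (𝕜) in
/-- The elementary tensor `x ⊗ y`, as an element of the completion. -/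
noncomputable def tmul (x : E) (y : F) : CompletedInductiveTensor 𝕜 E F :=
  ((InductiveTensor.tmul 𝕜 x y : InductiveTensor 𝕜 E F) : CompletedInductiveTensor 𝕜 E F)

variable (𝕜 E) in
/-- The continuous linear extension of `id ⊗ g` to the completions. -/
noncomputable def lmap (g : F →L[𝕜] F') :
    CompletedInductiveTensor 𝕜 E F →L[𝕜] CompletedInductiveTensor 𝕜 E F' :=
  (InductiveTensor.lmap 𝕜 E g).completion

theorem lmap_tmul (g : F →L[𝕜] F') (x : E) (y : F) :
    lmap 𝕜 E g (tmul 𝕜 x y) = tmul 𝕜 x (g y) :=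
  ContinuousLinearMap.completion_apply_coe _ _

end CompletedInductiveTensor

/-! ### Locally convex inductive limits of sequences -/

/-- The algebraic inductive limit of a sequence of topological vector spaces `G k` with continuous
linear linking maps `u k l : G k → G l` for `k ≤ l`. -/
def IndLim {𝕜 : Type*} [RCLike 𝕜] (G : ℕ → Type*) [∀ k, AddCommGroup (G k)]
    [∀ k, Module 𝕜 (G k)] [∀ k, TopologicalSpace (G k)]
    (u : ∀ k l, k ≤ l → G k →L[𝕜] G l) : Type _ :=
  Module.DirectLimit G fun k l h => (u k l h : G k →ₗ[𝕜] G l)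

namespace IndLim

variable {𝕜 : Type*} [RCLike 𝕜] {G : ℕ → Type*} [∀ k, AddCommGroup (G k)]
  [∀ k, Module 𝕜 (G k)] [∀ k, TopologicalSpace (G k)] (u : ∀ k l, k ≤ l → G k →L[𝕜] G l)

noncomputable instance : AddCommGroup (IndLim G u) :=
  inferInstanceAs (AddCommGroup (Module.DirectLimit G fun k l h => (u k l h : G k →ₗ[𝕜] G l)))

noncomputable instance : Module 𝕜 (IndLim G u) :=
  inferInstanceAs (Module 𝕜 (Module.DirectLimit G fun k l h => (u k l h : G k →ₗ[𝕜] G l)))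

/-- The canonical linear map from the `k`-th step into the inductive limit. -/
noncomputable def of (k : ℕ) : G k →ₗ[𝕜] IndLim G u :=
  Module.DirectLimit.of 𝕜 ℕ G (fun k l h => (u k l h : G k →ₗ[𝕜] G l)) k

/-- The locally convex topologies on the limit for which all canonical maps are continuous. -/
def admissibleTopologies : Set (TopologicalSpace (IndLim G u)) :=
  {t | PolynormableSpace 𝕜 (IndLim G u) (topology := t) ∧
    ∀ k, Continuous[inferInstance, t] (of u k)}

/-- The inductive limit topology: the finest locally convex topology for which all canonical maps
from the steps are continuous; see `isLeast_topology`. -/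
@[reducible] def topology : TopologicalSpace (IndLim G u) :=
  sInf (admissibleTopologies u)

theorem isLeast_topology : IsLeast (admissibleTopologies u) (topology u) :=
  ⟨⟨PolynormableSpace.sInf fun _ ht => ht.1,
    fun k => continuous_sInf_rng.2 fun _ ht => ht.2 k⟩, fun _ ht => sInf_le ht⟩

theorem isTopologicalAddGroup_topology :
    @IsTopologicalAddGroup (IndLim G u) (topology u) _ :=
  letI := topology u
  haveI : PolynormableSpace 𝕜 (IndLim G u) := (isLeast_topology u).1.1
  (PolynormableSpace.withSeminorms 𝕜 (IndLim G u)).topologicalAddGroup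

/-- The limit carries the inductive limit topology and the uniform structure that belongs to it. -/
noncomputable instance : UniformSpace (IndLim G u) :=
  @IsTopologicalAddGroup.rightUniformSpace _ _ (topology u) (isTopologicalAddGroup_topology u)

theorem toTopologicalSpace_eq :
    (inferInstance : TopologicalSpace (IndLim G u)) = topology u := rfl

instance : PolynormableSpace 𝕜 (IndLim G u) :=
  (isLeast_topology u).1.1

instance : ContinuousSMul 𝕜 (IndLim G u) :=
  (PolynormableSpace.withSeminorms 𝕜 (IndLim G u)).continuousSMul

instance : IsUniformAddGroup (IndLim G u) :=
  letI := topology u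
  haveI := isTopologicalAddGroup_topology u
  isUniformAddGroup_of_addCommGroup

instance : UniformContinuousConstSMul 𝕜 (IndLim G u) :=
  uniformContinuousConstSMul_of_continuousConstSMul 𝕜 _

end IndLim

/-! Both spaces are determined by the same data: families, compatible in `k`, of partially
continuous bilinear maps on the products of `E` with the steps. Partial continuity is what lets the
tensor product pass through the limit. For fixed `x`, the map `[y] ↦ [x ⊗ y]` is continuous by the
universal property of the limit (`IndLim.continuous_of_comp_of`); a fixed `z` comes from a single
step, so continuity in `x` is inherited from that step. The resulting map extends to the completion
because the target is Hausdorff and complete. In the other direction, the maps from `E ⊗̂_ι G k`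
obtained by extending `id ⊗ of u k` glue, since a completion of a locally convex space is again
locally convex. The two maps are inverse to each other on elementary tensors, hence everywhere by
density (`hom_ext`). -/

/-! ### Local convexity of completions. -/

/-- The extension of a continuous seminorm to the completion. -/
noncomputable def Seminorm.completion {𝕜 V : Type*} [RCLike 𝕜] [AddCommGroup V] [Module 𝕜 V]
    [UniformSpace V] [IsUniformAddGroup V] [UniformContinuousConstSMul 𝕜 V] (p : Seminorm 𝕜 V)
    (hp : Continuous p) : Seminorm 𝕜 (UniformSpace.Completion V) :=
  have hu : UniformContinuous p := Seminorm.uniformContinuous_of_continuousAt_zero hp.continuousAt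
  Seminorm.of (UniformSpace.Completion.extension p)
    (fun x y => by
      induction x, y using UniformSpace.Completion.induction_on₂ with
      | hp =>
        exact isClosed_le
          (UniformSpace.Completion.continuous_extension.comp (continuous_fst.add continuous_snd))
          ((UniformSpace.Completion.continuous_extension.comp continuous_fst).add
            (UniformSpace.Completion.continuous_extension.comp continuous_snd))
      | ih x y =>
        rw [← UniformSpace.Completion.coe_add]
        simp only [UniformSpace.Completion.extension_coe hu]
        exact map_add_le_add p x y)
    (fun a x => by
      induction x using UniformSpace.Completion.induction_on with
      | hp =>
        exact isClosed_eq
          (UniformSpace.Completion.continuous_extension.comp (continuous_const_smul a))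
          (continuous_const.mul UniformSpace.Completion.continuous_extension)
      | ih x =>
        rw [← UniformSpace.Completion.coe_smul]
        simp only [UniformSpace.Completion.extension_coe hu]
        exact map_smul_eq_mul p a x)

section Completion

variable {𝕜 V : Type*} [RCLike 𝕜] [AddCommGroup V] [Module 𝕜 V] [UniformSpace V]
  [IsUniformAddGroup V] [UniformContinuousConstSMul 𝕜 V]

theorem Seminorm.continuous_completion (p : Seminorm 𝕜 V) (hp : Continuous p) :
    Continuous (p.completion hp) :=
  UniformSpace.Completion.continuous_extension

theorem Seminorm.completion_coe (p : Seminorm 𝕜 V) (hp : Continuous p) (x : V) :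
    p.completion hp (x : UniformSpace.Completion V) = p x :=
  UniformSpace.Completion.extension_coe
    (Seminorm.uniformContinuous_of_continuousAt_zero hp.continuousAt) x

/-- The completion of a locally convex space is locally convex. -/
instance UniformSpace.Completion.polynormableSpace [PolynormableSpace 𝕜 V] :
    PolynormableSpace 𝕜 (UniformSpace.Completion V) where
  withSeminorms' := by
    rw [SeminormFamily.withSeminorms_iff_nhds_eq_iInf]
    refine le_antisymm ?_ fun U hU => ?_
    · simp_rw [le_iInf_iff, ← Filter.tendsto_iff_comap]
      intro ⟨p, hp⟩
      exact hp.tendsto' 0 0 (map_zero _)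
    -- A closed neighbourhood `C` can be tested on the dense image of `V`.
    · obtain ⟨C, ⟨hC, hCc⟩, hCU⟩ := (closed_nhds_basis (0 : UniformSpace.Completion V)).mem_iff.1 hU
      have hC' : ((↑) : V → UniformSpace.Completion V) ⁻¹' C ∈ 𝓝 (0 : V) :=
        (UniformSpace.Completion.continuous_coe V).continuousAt.preimage_mem_nhds
          (by rwa [UniformSpace.Completion.coe_zero])
      have hV := PolynormableSpace.withSeminorms 𝕜 V
      obtain ⟨s, r, hr, hs⟩ := (hV.mem_nhds_iff 0 _).1 hC'
      let q : Seminorm 𝕜 V := s.sup fun p : {p : Seminorm 𝕜 V // Continuous p} => p.1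
      have hq : Continuous q := Seminorm.continuous_finsetSup fun p _ => p.2
      have hq' := q.continuous_completion hq
      refine Filter.mem_of_superset (Filter.mem_iInf_of_mem ⟨q.completion hq, hq'⟩
        (Filter.preimage_mem_comap (Iio_mem_nhds hr))) ?_
      refine subset_trans ?_ hCU
      intro x hx
      -- The open `r`-ball of the extended seminorm lies in the closure of its trace on the dense
      -- image of `V`, and that trace lies in `C`.
      have hopen : IsOpen {z | q.completion hq z < r} := isOpen_Iio.preimage hq'
      have hsub : {z | q.completion hq z < r} ∩ Set.range ((↑) : V → UniformSpace.Completion V)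
          ⊆ C := by
        rintro _ ⟨hz, v, rfl⟩
        refine hs ?_
        rw [Seminorm.mem_ball_zero]
        rwa [Set.mem_ofPred_eq, Seminorm.completion_coe] at hz
      exact hCc.closure_subset_iff.2 hsub
        (UniformSpace.Completion.denseRange_coe.open_subset_closure_inter hopen hx)

end Completion

/-! ### Universal property of the locally convex inductive limit. -/

namespace IndLim

variable {𝕜 : Type*} [RCLike 𝕜] {G : ℕ → Type*} [∀ k, AddCommGroup (G k)]
  [∀ k, Module 𝕜 (G k)] [∀ k, TopologicalSpace (G k)] (u : ∀ k l, k ≤ l → G k →L[𝕜] G l)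
  {Z : Type*} [AddCommGroup Z] [Module 𝕜 Z]

theorem continuous_of (k : ℕ) : Continuous (of u k) :=
  (isLeast_topology u).1.2 k

/-- The canonical map from the `k`-th step into the limit, as a continuous linear map. -/
noncomputable def ofL (k : ℕ) : G k →L[𝕜] IndLim G u :=
  ⟨of u k, continuous_of u k⟩

theorem of_link {k l : ℕ} (h : k ≤ l) (x : G k) : of u l (u k l h x) = of u k x :=
  Module.DirectLimit.of_f (f := fun k l h => (u k l h : G k →ₗ[𝕜] G l)) (hij := h)

theorem exists_of (z : IndLim G u) : ∃ k x, of u k x = z :=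
  Module.DirectLimit.exists_of z

/-- A linear map on the limit is given by a compatible family of linear maps on the steps. -/
noncomputable def liftₗ (g : ∀ k, G k →ₗ[𝕜] Z) (hg : ∀ k l h x, g l (u k l h x) = g k x) :
    IndLim G u →ₗ[𝕜] Z :=
  Module.DirectLimit.lift 𝕜 ℕ G (fun k l h => (u k l h : G k →ₗ[𝕜] G l)) g hg

theorem liftₗ_of (g : ∀ k, G k →ₗ[𝕜] Z) (hg : ∀ k l h x, g l (u k l h x) = g k x) (k : ℕ)
    (x : G k) : liftₗ u g hg (of u k x) = g k x :=
  Module.DirectLimit.lift_of (f := fun k l h => (u k l h : G k →ₗ[𝕜] G l)) g hg x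

variable {u} [TopologicalSpace Z] [PolynormableSpace 𝕜 Z]

/-- The topology induced by `f` is admissible, so the limit topology, being the finest such, is
finer. -/
theorem continuous_of_comp_of (f : IndLim G u →ₗ[𝕜] Z)
    (h : ∀ k, Continuous fun x => f (of u k x)) : Continuous f := by
  rw [continuous_iff_le_induced]
  exact (isLeast_topology u).2 ⟨PolynormableSpace.induced f, fun k => continuous_induced_rng.2 (h k)⟩

variable (u) in
/-- The universal property of the locally convex inductive limit. -/
noncomputable def lift (g : ∀ k, G k →L[𝕜] Z) (hg : ∀ k l h x, g l (u k l h x) = g k x) :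
    IndLim G u →L[𝕜] Z where
  toLinearMap := liftₗ u (fun k => (g k : G k →ₗ[𝕜] Z)) hg
  cont := continuous_of_comp_of _ fun k => by
    simp only [liftₗ_of]
    exact (g k).continuous

theorem lift_of (g : ∀ k, G k →L[𝕜] Z) (hg : ∀ k l h x, g l (u k l h x) = g k x) (k : ℕ)
    (x : G k) : lift u g hg (of u k x) = g k x :=
  liftₗ_of u (fun k => (g k : G k →ₗ[𝕜] Z)) hg k x

end IndLim

/-! ### Elementary tensors in the completed tensor product. -/

namespace CompletedInductiveTensor

section

variable {𝕜 E F : Type*} [RCLike 𝕜] [AddCommGroup E] [Module 𝕜 E] [AddCommGroup F] [Module 𝕜 F]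
  [TopologicalSpace E] [TopologicalSpace F]

variable (𝕜 E) in
theorem continuous_tmul_left (y : F) : Continuous fun x : E => tmul 𝕜 x y :=
  (UniformSpace.Completion.continuous_coe _).comp
    ((InductiveTensor.isLeast_topology 𝕜 E F).1.2.2 y)

variable (𝕜 F) in
theorem continuous_tmul_right (x : E) : Continuous fun y : F => tmul 𝕜 x y :=
  (UniformSpace.Completion.continuous_coe _).comp
    ((InductiveTensor.isLeast_topology 𝕜 E F).1.2.1 x)

variable (𝕜 E F) in
/-- The canonical map to the completion, as a linear map. -/
noncomputable def coeₗ : InductiveTensor 𝕜 E F →ₗ[𝕜] CompletedInductiveTensor 𝕜 E F where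
  toFun := (↑)
  map_add' := UniformSpace.Completion.coe_add
  map_smul' := UniformSpace.Completion.coe_smul

variable (𝕜 E F) in
/-- The canonical bilinear map `E × F → E ⊗̂_ι F`. -/
noncomputable def mk : E →ₗ[𝕜] F →ₗ[𝕜] CompletedInductiveTensor 𝕜 E F :=
  (InductiveTensor.mk 𝕜 E F).compr₂ (coeₗ 𝕜 E F)

/-- Continuous linear maps on `E ⊗̂_ι F` are determined by the elementary tensors. -/
theorem hom_ext {Z : Type*} [AddCommGroup Z] [Module 𝕜 Z] [TopologicalSpace Z] [T2Space Z]
    {f g : CompletedInductiveTensor 𝕜 E F →L[𝕜] Z}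
    (h : ∀ x y, f (tmul 𝕜 x y) = g (tmul 𝕜 x y)) : f = g := by
  -- Elementary tensors span the algebraic tensor product, whose image is dense; `Z` is Hausdorff,
  -- so agreement passes to the completion.
  have halg : (f : CompletedInductiveTensor 𝕜 E F →ₗ[𝕜] Z) ∘ₗ coeₗ 𝕜 E F =
      (g : CompletedInductiveTensor 𝕜 E F →ₗ[𝕜] Z) ∘ₗ coeₗ 𝕜 E F :=
    TensorProduct.ext' h
  ext z
  induction z using UniformSpace.Completion.induction_on with
  | hp => exact isClosed_eq f.continuous g.continuous
  | ih z => exact LinearMap.congr_fun halg z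

end

/-! ### The two canonical maps and the isomorphism. -/

variable {𝕜 : Type*} [RCLike 𝕜] {E : Type*} [AddCommGroup E] [Module 𝕜 E] [TopologicalSpace E]
  {G : ℕ → Type*} [∀ k, AddCommGroup (G k)] [∀ k, Module 𝕜 (G k)] [∀ k, TopologicalSpace (G k)]
  (u : ∀ k l, k ≤ l → G k →L[𝕜] G l)

variable (E) in
/-- The inductive limit of the completed inductive tensor products `E ⊗̂_ι G k`. -/
abbrev TensorIndLim : Type _ :=
  IndLim (fun k => CompletedInductiveTensor 𝕜 E (G k)) fun k l h => lmap 𝕜 E (u k l h)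

variable (E) in
/-- The canonical map from the `k`-th step `E ⊗̂_ι G k`. -/
noncomputable abbrev ofTensor (k : ℕ) :
    CompletedInductiveTensor 𝕜 E (G k) →L[𝕜] TensorIndLim E u :=
  IndLim.ofL (fun k l h => lmap 𝕜 E (u k l h)) k

variable (E) in
/-- The bilinear map `([y], x) ↦ [x ⊗ y]`. -/
noncomputable def indLimBilin : IndLim G u →ₗ[𝕜] E →ₗ[𝕜] TensorIndLim E u :=
  -- The limit variable comes first so that the algebraic lift applies, with values in linear maps
  -- on `E`; continuity is checked afterwards in each variable.
  IndLim.liftₗ u (fun k => (mk 𝕜 E (G k)).flip.compr₂ (ofTensor E u k).toLinearMap) fun k l h y => by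
    ext x
    change ofTensor E u l (tmul 𝕜 x (u k l h y)) = ofTensor E u k (tmul 𝕜 x y)
    rw [← lmap_tmul]
    exact IndLim.of_link (fun k l h => lmap 𝕜 E (u k l h)) h _

theorem indLimBilin_of (k : ℕ) (x : E) (y : G k) :
    indLimBilin E u (IndLim.of u k y) x = ofTensor E u k (tmul 𝕜 x y) := by
  rw [indLimBilin, IndLim.liftₗ_of]
  rfl

variable (E) in
/-- The continuous linear map `x ⊗ [y] ↦ [x ⊗ y]` on the algebraic tensor product. -/
noncomputable def tensorIndLimMap :
    InductiveTensor 𝕜 E (IndLim G u) →L[𝕜] TensorIndLim E u where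
  toLinearMap := TensorProduct.lift (indLimBilin E u).flip
  cont := by
    refine InductiveTensor.continuous_of_partial (TensorProduct.lift (indLimBilin E u).flip)
      (fun x => ?_) fun z => ?_
    · change Continuous ((indLimBilin E u).flip x)
      refine IndLim.continuous_of_comp_of _ fun k => ?_
      simp only [LinearMap.flip_apply, indLimBilin_of]
      exact (ofTensor E u k).continuous.comp (continuous_tmul_right 𝕜 (G k) x)
    · change Continuous (indLimBilin E u z)
      -- The step `k` may depend on `z`, which is harmless for partial continuity.
      obtain ⟨k, y, rfl⟩ := IndLim.exists_of u z
      have h : ⇑(indLimBilin E u (IndLim.of u k y)) = fun x => ofTensor E u k (tmul 𝕜 x y) :=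
        funext fun x => indLimBilin_of u k x y
      rw [h]
      exact (ofTensor E u k).continuous.comp (continuous_tmul_left 𝕜 E y)

theorem tensorIndLimMap_tmul (k : ℕ) (x : E) (y : G k) :
    tensorIndLimMap E u (InductiveTensor.tmul 𝕜 x (IndLim.of u k y)) =
      ofTensor E u k (tmul 𝕜 x y) :=
  indLimBilin_of u k x y

variable (E) in
/-- The continuous linear map `[x ⊗ y] ↦ x ⊗ [y]`. -/
noncomputable def fromTensorIndLim :
    TensorIndLim E u →L[𝕜] CompletedInductiveTensor 𝕜 E (IndLim G u) :=
  -- The lift requires a locally convex target, here a completion.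
  IndLim.lift (fun k l h => lmap 𝕜 E (u k l h)) (fun k => lmap 𝕜 E (IndLim.ofL u k))
    fun k l h z => by
      have H : (lmap 𝕜 E (IndLim.ofL u l)).comp (lmap 𝕜 E (u k l h)) =
          lmap 𝕜 E (IndLim.ofL u k) := hom_ext fun x y => by
        rw [ContinuousLinearMap.comp_apply, lmap_tmul, lmap_tmul, lmap_tmul]
        exact congrArg (tmul 𝕜 x) (IndLim.of_link u h y)
      exact DFunLike.congr_fun H z

theorem fromTensorIndLim_ofTensor (k : ℕ) (x : E) (y : G k) :
    fromTensorIndLim E u (ofTensor E u k (tmul 𝕜 x y)) = tmul 𝕜 x (IndLim.of u k y) :=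
  (IndLim.lift_of (u := fun k l h => lmap 𝕜 E (u k l h)) (fun k => lmap 𝕜 E (IndLim.ofL u k)) _ k
    (tmul 𝕜 x y)).trans (lmap_tmul (IndLim.ofL u k) x y)

variable [T2Space (TensorIndLim E u)] [CompleteSpace (TensorIndLim E u)]

variable (E) in
/-- The continuous linear map `x ⊗ [y] ↦ [x ⊗ y]` on the completed tensor product. -/
noncomputable def toTensorIndLim :
    CompletedInductiveTensor 𝕜 E (IndLim G u) →L[𝕜] TensorIndLim E u :=
  (tensorIndLimMap E u).fromCompletion

theorem toTensorIndLim_tmul (k : ℕ) (x : E) (y : G k) :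
    toTensorIndLim E u (tmul 𝕜 x (IndLim.of u k y)) = ofTensor E u k (tmul 𝕜 x y) :=
  ((tensorIndLimMap E u).fromCompletion_apply_coe _).trans (tensorIndLimMap_tmul u k x y)

variable (E) in
/-- The completed inductive tensor product commutes with inductive limits of sequences, if the
limit of the tensor products is Hausdorff and complete. -/
noncomputable def indLimEquiv :
    CompletedInductiveTensor 𝕜 E (IndLim G u) ≃L[𝕜] TensorIndLim E u :=
  ContinuousLinearEquiv.equivOfInverse (toTensorIndLim E u) (fromTensorIndLim E u)
    (by
      have h : (fromTensorIndLim E u).comp (toTensorIndLim E u) = .id 𝕜 _ := hom_ext fun x z => by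
        obtain ⟨k, y, rfl⟩ := IndLim.exists_of u z
        rw [ContinuousLinearMap.comp_apply, toTensorIndLim_tmul, fromTensorIndLim_ofTensor]
        rfl
      exact DFunLike.congr_fun h)
    (fun z => by
      obtain ⟨k, w, rfl⟩ := IndLim.exists_of _ z
      -- Within one step, `hom_ext` applies because the limit is assumed Hausdorff.
      have h : ((toTensorIndLim E u).comp (fromTensorIndLim E u)).comp (ofTensor E u k) =
          ofTensor E u k := hom_ext fun x y => by
        rw [ContinuousLinearMap.comp_apply, ContinuousLinearMap.comp_apply,
          fromTensorIndLim_ofTensor, toTensorIndLim_tmul]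
      exact DFunLike.congr_fun h w)

theorem indLimEquiv_tmul (k : ℕ) (x : E) (y : G k) :
    indLimEquiv E u (tmul 𝕜 x (IndLim.of u k y)) = ofTensor E u k (tmul 𝕜 x y) :=
  toTensorIndLim_tmul u k x y

end CompletedInductiveTensor

/-- `u` is the system of linking maps between the strong duals `F k'`; the completed inductive
tensor products `E ⊗̂_ι F k'` are linked by the extensions of `id ⊗ u k l`. The isomorphism is the
canonical one. -/
theorem proposition2p5 {𝕜 : Type*} [RCLike 𝕜]
    {E : Type*} [AddCommGroup E] [Module 𝕜 E] [UniformSpace E] [FrechetSpace 𝕜 E]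
    {F : ℕ → Type*} [∀ k, AddCommGroup (F k)] [∀ k, Module 𝕜 (F k)] [∀ k, UniformSpace (F k)]
    [∀ k, FrechetSpace 𝕜 (F k)]
    (u : ∀ k l, k ≤ l → StrongDual 𝕜 (F k) →L[𝕜] StrongDual 𝕜 (F l))
    (hu_id : ∀ k, u k k le_rfl = ContinuousLinearMap.id 𝕜 (StrongDual 𝕜 (F k)))
    (hu_comp : ∀ k l m (hkl : k ≤ l) (hlm : l ≤ m),
      (u l m hlm).comp (u k l hkl) = u k m (hkl.trans hlm))
    (hT2 : T2Space (IndLim (fun k => CompletedInductiveTensor 𝕜 E (StrongDual 𝕜 (F k)))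
      fun k l h => CompletedInductiveTensor.lmap 𝕜 E (u k l h)))
    (hcomplete : CompleteSpace (IndLim (fun k => CompletedInductiveTensor 𝕜 E (StrongDual 𝕜 (F k)))
      fun k l h => CompletedInductiveTensor.lmap 𝕜 E (u k l h))) :
    ∃ Φ : CompletedInductiveTensor 𝕜 E (IndLim (fun k => StrongDual 𝕜 (F k)) u) ≃L[𝕜]
        IndLim (fun k => CompletedInductiveTensor 𝕜 E (StrongDual 𝕜 (F k)))
          (fun k l h => CompletedInductiveTensor.lmap 𝕜 E (u k l h)),
      ∀ (k : ℕ) (x : E) (y : StrongDual 𝕜 (F k)),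
        Φ (CompletedInductiveTensor.tmul 𝕜 x (IndLim.of u k y)) =
          IndLim.of (fun k l h => CompletedInductiveTensor.lmap 𝕜 E (u k l h)) k
            (CompletedInductiveTensor.tmul 𝕜 x y) := by
  exact ⟨CompletedInductiveTensor.indLimEquiv E u,
    CompletedInductiveTensor.indLimEquiv_tmul u⟩
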